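/- Let $L^2([0,1])$ and $L^2([0,1]^2)$ be the spaces of (a.e. classes of) real-valued square-integrable functions. For given $y\in L^2([0,1]^2)$, call $x\in L^2([0,1]^2)$ a non-negative factored solution (in the limited data case) if $$\int_0^{s_2}\!\int_0^{s_1} x(s_1-t_1,s_2-t_2)\,x(t_1,t_2)\,dt_1\,dt_2 = y(s_1,s_2)\quad\text{for a.e. }(s_1,s_2)\in[0,1]^2,$$ and if there are $x_1,x_2\in L^2([0,1])$ with $x_1\ge 0$ and $x_2\ge 0$ a.e. on $[0,1]$ such that $x(t_1,t_2)=x_1(t_1)\,x_2(t_2)$ for a.e. $(t_1,t_2)\in[0,1]^2$. Theorem 2.3. Let $y\in L^2([0,1]^2)$ and let $x^\dagger$ be a non-negative factored solution with $(0,0)\in\operatorname{supp}(x^\dagger)$, i.e. for every neighbourhood $U$ of the origin the set $\{t\in U\cap[0,1]^2 : x^\dagger(t)\neq 0\}$ has positive Lebesgue measure. Then there is no other non-negative factored solution for this $y$: every non-negative factored solution $x\in L^2([0,1]^2)$ satisfies $x=x^\dagger$ a.e. on $[0,1]^2$. -/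

import Mathlib

open MeasureTheory Set Filter Topology
open scoped ENNReal

/-- Lebesgue measure on the unit interval `[0,1]`. -/
noncomputable abbrev unitIntervalMeasure : Measure ℝ :=
  volume.restrict (Icc 0 1)

/-- Lebesgue measure on the unit square `[0,1]²` (an interval for the componentwise order). -/
noncomputable abbrev unitSquareMeasure : Measure (ℝ × ℝ) :=
  volume.restrict (Icc (0, 0) (1, 1))

/-- The real Hilbert space `L²([0,1])`. -/
noncomputable abbrev L2Interval : Type := Lp ℝ 2 unitIntervalMeasure

/-- The real Hilbert space `L²([0,1]²)`. -/
noncomputable abbrev L2Square : Type := Lp ℝ 2 unitSquareMeasure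

/-- The autoconvolution of a function of two variables,
`(s₁, s₂) ↦ ∫₀^{s₂} ∫₀^{s₁} x (s₁ - t₁, s₂ - t₂) x (t₁, t₂) dt₁ dt₂`, to be used for
`(s₁, s₂) ∈ [0,1]²`, where only the values of `x` on `[0,1]²` enter and
changing `x` on a null set has no effect. -/
noncomputable def autoconv (x : ℝ × ℝ → ℝ) (s : ℝ × ℝ) : ℝ :=
  ∫ t₂ in (0 : ℝ)..s.2, ∫ t₁ in (0 : ℝ)..s.1, x (s.1 - t₁, s.2 - t₂) * x (t₁, t₂)

/-- `x ∈ L²([0,1]²)` solves `x * x = y` in the limited data case: the equation holds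
a.e. on `[0,1]²`. -/
def IsLimitedSolution (y x : L2Square) : Prop :=
  autoconv x =ᵐ[unitSquareMeasure] y

/-- A non-negative factored solution in the limited data case: a solution of the form
`x(t₁,t₂) = x₁(t₁) x₂(t₂)` with `x₁, x₂ ∈ L²([0,1])` non-negative a.e. -/
def IsNonnegFactoredLimitedSolution (y x : L2Square) : Prop :=
  IsLimitedSolution y x ∧
    ∃ x₁ x₂ : L2Interval,
      (∀ᵐ t ∂unitIntervalMeasure, 0 ≤ x₁ t) ∧ (∀ᵐ t ∂unitIntervalMeasure, 0 ≤ x₂ t) ∧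
        ∀ᵐ t ∂unitSquareMeasure, x t = x₁ t.1 * x₂ t.2

/-- The (essential) support of `x ∈ L²([0,1]²)`: the points all of whose neighbourhoods meet
`{t ∈ [0,1]² | x t ≠ 0}` in a set of positive Lebesgue measure. -/
def essSupport (x : L2Square) : Set (ℝ × ℝ) :=
  {p | ∀ U ∈ 𝓝 p, 0 < volume {t | t ∈ U ∩ Icc (0, 0) (1, 1) ∧ x t ≠ 0}}

/-! For factored `x` the equation reads (x₁*x₁)(s₁)·(x₂*x₂)(s₂) = y(s₁,s₂). Comparing two solutions
and separating variables (`exists_pos_ae_eq_const_mul_of_ae_mul_eq_mul`) gives c > 0 with x₁*x₁ =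
c·(x₁'*x₁') and x₂'*x₂' = c·(x₂*x₂) on [0,1]. Then (x₁ - √c x₁')*(x₁ + √c x₁') = 0 there; the second
factor is non-negative with 0 in its support, so the first vanishes. Likewise x₂ = √c⁻¹ x₂', and the
constants cancel.

The cancellation is a case of Titchmarsh's theorem, `ae_eq_zero_of_convolution_eq_zero`.
Non-negativity bounds the Laplace transform of g from below, so that of f decays exponentially;
`setIntegral_Iic_eq_zero_of_exp_moment_bound` turns this decay into vanishing of f. -/

open scoped Convolution
-- Vanishing of a function from bounds on its exponential moments
theorem ae_eq_zero_of_forall_setIntegral_Iic_eq_zero {f : ℝ → ℝ} (hf : Integrable f) {T : ℝ}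
    (h : ∀ b < T, ∫ t in Iic b, f t = 0) : ∀ᵐ x : ℝ, x < T → f x = 0 := by
  filter_upwards [LocallyIntegrable.ae_hasDerivAt_integral hf.locallyIntegrable] with x hx hxT
  refine (hx (T - 1)).unique ((hasDerivAt_const x (0 : ℝ)).congr_of_eventuallyEq ?_)
  filter_upwards [Iio_mem_nhds hxT] with y hy
  rw [← intervalIntegral.integral_Iic_sub_Iic hf.integrableOn hf.integrableOn,
    h y hy, h (T - 1) (by linarith), sub_zero]

theorem hasSum_exp_sub_one (x : ℝ) :
    HasSum (fun k : ℕ => x ^ (k + 1) / (k + 1).factorial) (Real.exp x - 1) := by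
  have h := NormedSpace.expSeries_div_hasSum_exp x
  rw [← Real.exp_eq_exp_ℝ] at h
  simpa using (hasSum_nat_add_iff' 1).mpr h

/-- Expanding `exp (-exp (n (b - t))) - 1` into exponentials transfers exponential moment bounds. -/
theorem abs_integral_exp_neg_exp_sub_one_mul_le {f : ℝ → ℝ} (hf : Integrable f)
    (hf0 : ∀ t < 0, f t = 0) {a b C : ℝ}
    (hC : ∀ n : ℕ, |∫ t, Real.exp (n * (a - t)) * f t| ≤ C) (n : ℕ) :
    |∫ t, (Real.exp (-Real.exp (n * (b - t))) - 1) * f t| ≤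
      C * (Real.exp (Real.exp (n * (b - a))) - 1) := by
  set M := Real.exp (n * b)
  set F : ℕ → ℝ → ℝ := fun k t =>
    (-Real.exp (n * (b - t))) ^ (k + 1) / (k + 1).factorial * f t with hF
  have hbound : ∀ k t, ‖F k t‖ ≤ M ^ (k + 1) / (k + 1).factorial * ‖f t‖ := by
    intro k t
    rcases lt_or_ge t 0 with ht | ht
    · simp [hF, hf0 t ht]
    · simp only [hF, norm_mul, norm_div, norm_pow, norm_neg, Real.norm_eq_abs, Real.abs_exp,
        Nat.abs_cast]
      gcongr
      refine Real.exp_le_exp.mpr (mul_le_mul_of_nonneg_left ?_ n.cast_nonneg)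
      linarith
  have hint : ∀ k, Integrable (F k) := by
    intro k
    refine (hf.norm.const_mul (M ^ (k + 1) / (k + 1).factorial)).mono' ?_
      (Eventually.of_forall (hbound k))
    refine AEStronglyMeasurable.mul ?_ hf.aestronglyMeasurable
    exact Continuous.aestronglyMeasurable (by fun_prop)
  have hsum : Summable fun k => ∫ t, ‖F k t‖ := by
    refine Summable.of_nonneg_of_le (fun k => integral_nonneg fun t => norm_nonneg _)
      (fun k => ?_) ((hasSum_exp_sub_one M).summable.mul_right (∫ t, ‖f t‖))
    rw [← integral_const_mul]
    exact integral_mono (hint k).norm (hf.norm.const_mul _) (hbound k)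
  have h := hasSum_integral_of_summable_integral_norm hint hsum
  have heq : ∀ t, ∑' k, F k t = (Real.exp (-Real.exp (n * (b - t))) - 1) * f t := fun t =>
    ((hasSum_exp_sub_one _).mul_right (f t)).tsum_eq
  simp only [heq] at h
  refine h.norm_le_of_bounded ((hasSum_exp_sub_one (Real.exp (n * (b - a)))).mul_left C) ?_
  intro k
  -- The k-th term is a moment of integer order n(k+1), so `hC` at natural numbers suffices.
  have hk : ∫ t, F k t = (-1) ^ (k + 1) * (Real.exp (n * (b - a)) ^ (k + 1) / (k + 1).factorial) *
      ∫ t, Real.exp ((n * (k + 1) : ℕ) * (a - t)) * f t := by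
    rw [← integral_const_mul]
    congr 1 with t
    simp only [hF]
    rw [neg_pow, ← Real.exp_nat_mul, ← Real.exp_nat_mul]
    have : Real.exp ((k + 1 : ℕ) * (n * (b - t))) =
        Real.exp ((k + 1 : ℕ) * (n * (b - a))) * Real.exp ((n * (k + 1) : ℕ) * (a - t)) := by
      rw [← Real.exp_add]; congr 1; push_cast; ring
    rw [this]; ring
  rw [hk, norm_mul, norm_mul, mul_comm C]
  have h1 : ‖(-1 : ℝ) ^ (k + 1)‖ = 1 := by simp
  rw [h1, one_mul, Real.norm_of_nonneg (by positivity)]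
  exact mul_le_mul_of_nonneg_left (hC _) (by positivity)

theorem tendsto_exp_natCast_mul_of_neg {c : ℝ} (hc : c < 0) :
    Tendsto (fun n : ℕ => Real.exp (n * c)) atTop (𝓝 0) :=
  Real.tendsto_exp_atBot.comp (tendsto_natCast_atTop_atTop.atTop_mul_const_of_neg hc)

/-- As n → ∞, exp(-exp(n(b-t))) - 1 tends to -1 for t < b and to 0 for t > b, while its integral
against f is at most C(exp(exp(n(b-a))) - 1), which tends to 0 because b < a. -/
theorem setIntegral_Iic_eq_zero_of_exp_moment_bound {f : ℝ → ℝ} (hf : Integrable f)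
    (hf0 : ∀ t < 0, f t = 0) {a b C : ℝ} (hab : b < a)
    (hC : ∀ n : ℕ, |∫ t, Real.exp (n * (a - t)) * f t| ≤ C) :
    ∫ t in Iic b, f t = 0 := by
  have hzero : Tendsto (fun n : ℕ => ∫ t, (Real.exp (-Real.exp (n * (b - t))) - 1) * f t)
      atTop (𝓝 0) := by
    refine squeeze_zero_norm (abs_integral_exp_neg_exp_sub_one_mul_le hf hf0 hC) ?_
    have h := (tendsto_exp_natCast_mul_of_neg (sub_neg.mpr hab)).rexp
    simpa using (h.sub_const 1).const_mul C
  have hlim : Tendsto (fun n : ℕ => ∫ t, (Real.exp (-Real.exp (n * (b - t))) - 1) * f t)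
      atTop (𝓝 (∫ t, (Iic b).indicator (fun t => -f t) t)) := by
    refine tendsto_integral_of_dominated_convergence (fun t => ‖f t‖) (fun n => ?_) hf.norm
      (fun n => Eventually.of_forall fun t => ?_) ?_
    · exact AEStronglyMeasurable.mul (Continuous.aestronglyMeasurable (by fun_prop))
        hf.aestronglyMeasurable
    · rw [norm_mul]
      refine mul_le_of_le_one_left (norm_nonneg _) ?_
      rw [Real.norm_eq_abs, abs_le]
      have h1 : Real.exp (-Real.exp (n * (b - t))) ≤ 1 :=
        Real.exp_le_one_iff.mpr (neg_nonpos.mpr (Real.exp_nonneg _))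
      constructor <;> linarith [Real.exp_pos (-Real.exp (n * (b - t)))]
    · filter_upwards [compl_mem_ae_iff.mpr (measure_singleton b)] with t ht
      rcases lt_or_gt_of_ne (show t ≠ b from ht) with h | h
      · have hexp : Tendsto (fun n : ℕ => Real.exp (n * (b - t))) atTop atTop :=
          Real.tendsto_exp_atTop.comp
            (tendsto_natCast_atTop_atTop.atTop_mul_const (sub_pos.mpr h))
        have := ((Real.tendsto_exp_neg_atTop_nhds_zero.comp hexp).sub_const 1).mul_const (f t)
        rw [indicator_of_mem (mem_Iic.mpr h.le)]
        simpa using this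
      · have := ((tendsto_exp_natCast_mul_of_neg (sub_neg.mpr h)).neg.rexp.sub_const 1).mul_const
          (f t)
        rw [indicator_of_notMem (by simpa using h)]
        simpa using this
  have h := tendsto_nhds_unique hlim hzero
  rw [integral_indicator measurableSet_Iic, integral_neg, neg_eq_zero] at h
  exact h

/-! ### Laplace transforms and the Titchmarsh theorem -/

theorem integrable_exp_neg_mul_of_support_nonneg {f : ℝ → ℝ} (hf : Integrable f)
    (hf0 : ∀ t < 0, f t = 0) (n : ℕ) : Integrable fun t => Real.exp (-(n * t)) * f t := by
  refine hf.norm.mono' (AEStronglyMeasurable.mul (Continuous.aestronglyMeasurable (by fun_prop))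
    hf.aestronglyMeasurable) (Eventually.of_forall fun t => ?_)
  rcases lt_or_ge t 0 with ht | ht
  · simp [hf0 t ht]
  · rw [norm_mul, Real.norm_of_nonneg (Real.exp_nonneg _)]
    exact mul_le_of_le_one_left (norm_nonneg _) (Real.exp_le_one_iff.mpr (by
      have : (0 : ℝ) ≤ n * t := by positivity
      linarith))

theorem convolution_exp_neg_mul (f g : ℝ → ℝ) (c x : ℝ) :
    ((fun t => Real.exp (-(c * t)) * f t) ⋆[ContinuousLinearMap.mul ℝ ℝ]
      (fun t => Real.exp (-(c * t)) * g t)) x =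
      Real.exp (-(c * x)) * (f ⋆[ContinuousLinearMap.mul ℝ ℝ] g) x := by
  simp only [convolution, ContinuousLinearMap.mul_apply']
  rw [← integral_const_mul]
  congr 1 with t
  have : Real.exp (-(c * x)) = Real.exp (-(c * t)) * Real.exp (-(c * (x - t))) := by
    rw [← Real.exp_add]; congr 1; ring
  rw [this]; ring

/-- The Titchmarsh convolution theorem on the half-line, for a non-negative second factor whose
support contains the origin. -/
theorem ae_eq_zero_of_convolution_eq_zero {f g : ℝ → ℝ} (hf : Integrable f) (hg : Integrable g)
    (hf0 : ∀ t < 0, f t = 0) (hg0 : ∀ t < 0, g t = 0) (hgnn : ∀ᵐ t, 0 ≤ g t)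
    (hgpos : ∀ ε > 0, 0 < ∫ t in Iic ε, g t) {T : ℝ}
    (h : ∀ᵐ x : ℝ, x < T → (f ⋆[ContinuousLinearMap.mul ℝ ℝ] g) x = 0) :
    ∀ᵐ x : ℝ, x < T → f x = 0 := by
  refine ae_eq_zero_of_forall_setIntegral_Iic_eq_zero hf fun b hb => ?_
  -- The gap b < a serves the moment criterion; the gap a < T makes g have positive mass on t ≤ T -
  -- a.
  obtain ⟨a, hba, haT⟩ := exists_between hb
  set c := ∫ t in Iic (T - a), g t
  have hc : 0 < c := hgpos _ (sub_pos.mpr haT)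
  set K := ∫ x, ‖(f ⋆[ContinuousLinearMap.mul ℝ ℝ] g) x‖
  have hfgi : Integrable (f ⋆[ContinuousLinearMap.mul ℝ ℝ] g) := 
    hf.integrable_convolution (ContinuousLinearMap.mul ℝ ℝ) hg
  refine setIntegral_Iic_eq_zero_of_exp_moment_bound (C := K / c) hf hf0 hba fun n => ?_
  have hfn := integrable_exp_neg_mul_of_support_nonneg hf hf0 n
  have hgn := integrable_exp_neg_mul_of_support_nonneg hg hg0 n
  have hprod : (∫ t, Real.exp (-(n * t)) * f t) * (∫ t, Real.exp (-(n * t)) * g t) =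
      ∫ x, Real.exp (-(n * x)) * (f ⋆[ContinuousLinearMap.mul ℝ ℝ] g) x := by
    have := integral_convolution (ContinuousLinearMap.mul ℝ ℝ) hfn hgn
    simpa only [convolution_exp_neg_mul, ContinuousLinearMap.mul_apply'] using this.symm
  have hright : |∫ x, Real.exp (-(n * x)) * (f ⋆[ContinuousLinearMap.mul ℝ ℝ] g) x| ≤
      Real.exp (-(n * T)) * K := by
    rw [← integral_const_mul, ← Real.norm_eq_abs]
    refine norm_integral_le_of_norm_le (hfgi.norm.const_mul (Real.exp (-(n * T)))) ?_
    filter_upwards [h] with x hx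
    rcases lt_or_ge x T with hxT | hxT
    · simp [hx hxT]
    · rw [norm_mul, Real.norm_of_nonneg (Real.exp_nonneg _)]
      gcongr
  have hleft : Real.exp (-(n * (T - a))) * c ≤ ∫ t, Real.exp (-(n * t)) * g t := by
    rw [← integral_const_mul]
    refine (setIntegral_mono_on_ae (hg.integrableOn.const_mul _) hgn.integrableOn
      measurableSet_Iic ?_).trans (setIntegral_le_integral hgn ?_)
    · filter_upwards [hgnn] with t ht hta
      have : t ≤ T - a := hta
      gcongr
    · filter_upwards [hgnn] with t ht
      positivity
  have hfa : ∫ t, Real.exp (n * (a - t)) * f t =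
      Real.exp (n * a) * ∫ t, Real.exp (-(n * t)) * f t := by
    rw [← integral_const_mul]
    congr 1 with t
    rw [← mul_assoc, ← Real.exp_add]
    congr 2; ring
  rw [hfa, le_div_iff₀ hc, abs_mul, Real.abs_exp]
  have hG : 0 < Real.exp (-(n * (T - a))) * c := by positivity
  have hmain : |∫ t, Real.exp (-(n * t)) * f t| * (Real.exp (-(n * (T - a))) * c) ≤
      Real.exp (-(n * T)) * K := by
    refine (mul_le_mul_of_nonneg_left hleft (abs_nonneg _)).trans ?_
    rw [← abs_of_pos (hG.trans_le hleft), ← abs_mul, hprod]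
    exact hright
  have hE : Real.exp (-(n * (T - a))) = Real.exp (-(n * T)) * Real.exp (n * a) := by
    rw [← Real.exp_add]; congr 1; ring
  rw [hE] at hmain
  refine le_of_mul_le_mul_left ?_ (Real.exp_pos (-(n * T)))
  linarith

/-! ### Autoconvolution on the half-line -/

theorem convolution_mul_self_eq_zero_of_neg {u : ℝ → ℝ} (hu0 : ∀ t < 0, u t = 0) {x : ℝ}
    (hx : x < 0) : (u ⋆[ContinuousLinearMap.mul ℝ ℝ] u) x = 0 := by
  rw [convolution, ← integral_zero ℝ ℝ]
  congr 1 with t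
  rcases lt_or_ge t 0 with ht | ht
  · simp [hu0 t ht]
  · simp [hu0 (x - t) (by linarith)]

theorem convolution_mul_self_nonneg {u : ℝ → ℝ} (hu : ∀ᵐ t, 0 ≤ u t) (x : ℝ) :
    0 ≤ (u ⋆[ContinuousLinearMap.mul ℝ ℝ] u) x := by
  refine integral_nonneg_of_ae ?_
  have h := (Measure.measurePreserving_sub_left volume x).quasiMeasurePreserving.ae hu
  filter_upwards [hu, h] with t h1 h2
  exact mul_nonneg h1 h2

theorem convolution_mul_self_const_mul (c : ℝ) (u : ℝ → ℝ) (x : ℝ) :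
    ((fun t => c * u t) ⋆[ContinuousLinearMap.mul ℝ ℝ] (fun t => c * u t)) x =
      c ^ 2 * (u ⋆[ContinuousLinearMap.mul ℝ ℝ] u) x := by
  simp only [convolution, ContinuousLinearMap.mul_apply']
  rw [← integral_const_mul]
  congr 1 with t
  ring

theorem ae_convolution_sub_add {u v : ℝ → ℝ} (hu : Integrable u) (hv : Integrable v) :
    ∀ᵐ x : ℝ, ((fun t => u t - v t) ⋆[ContinuousLinearMap.mul ℝ ℝ] (fun t => u t + v t)) x =
      (u ⋆[ContinuousLinearMap.mul ℝ ℝ] u) x - (v ⋆[ContinuousLinearMap.mul ℝ ℝ] v) x := by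
  let L := ContinuousLinearMap.mul ℝ ℝ
  filter_upwards [hu.ae_convolution_exists L hu, hu.ae_convolution_exists L hv,
    hv.ae_convolution_exists L hu, hv.ae_convolution_exists L hv] with x huu huv hvu hvv
  simp only [ConvolutionExistsAt, L, ContinuousLinearMap.mul_apply'] at huu huv hvu hvv
  simp only [convolution, ContinuousLinearMap.mul_apply']
  have hcomm : ∫ t, v t * u (x - t) = ∫ t, u t * v (x - t) := by
    rw [← integral_sub_left_eq_self (fun t => v t * u (x - t)) volume x]
    congr 1 with t
    rw [sub_sub_cancel, mul_comm]
  have hexp : ∀ t, (u t - v t) * (u (x - t) + v (x - t)) =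
      (u t * u (x - t) - v t * v (x - t)) + (u t * v (x - t) - v t * u (x - t)) := fun t => by
    ring
  simp only [hexp]
  rw [integral_add (by exact huu.sub hvv) (by exact huv.sub hvu), integral_sub huu hvv, integral_sub huv hvu, hcomm]
  ring

/-- A non-negative function on the half-line whose support contains the origin is determined by
its autoconvolution among all non-negative functions. -/
theorem ae_eq_of_convolution_mul_self_eq {u v : ℝ → ℝ} (hu : Integrable u) (hv : Integrable v)
    (hu0 : ∀ t < 0, u t = 0) (hv0 : ∀ t < 0, v t = 0) (hunn : ∀ᵐ t, 0 ≤ u t)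
    (hvnn : ∀ᵐ t, 0 ≤ v t) (hupos : ∀ ε > 0, 0 < ∫ t in Iic ε, u t) {T : ℝ}
    (h : ∀ᵐ x : ℝ, x < T → (u ⋆[ContinuousLinearMap.mul ℝ ℝ] u) x =
      (v ⋆[ContinuousLinearMap.mul ℝ ℝ] v) x) :
    ∀ᵐ x : ℝ, x < T → u x = v x := by
  have hz : ∀ᵐ x : ℝ, x < T →
      ((fun t => u t - v t) ⋆[ContinuousLinearMap.mul ℝ ℝ] (fun t => u t + v t)) x = 0 := by
    filter_upwards [h, ae_convolution_sub_add hu hv] with x hx hx' hxT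
    rw [hx', hx hxT, sub_self]
  have hmain := ae_eq_zero_of_convolution_eq_zero (hu.sub hv) (hu.add hv)
    (fun t ht => by simp [hu0 t ht, hv0 t ht]) (fun t ht => by simp [hu0 t ht, hv0 t ht])
    (by filter_upwards [hunn, hvnn] with t h1 h2 using add_nonneg h1 h2)
    (fun ε hε => by
      simp only [Pi.add_apply]
      rw [integral_add hu.integrableOn hv.integrableOn]
      exact add_pos_of_pos_of_nonneg (hupos ε hε)
        (integral_nonneg_of_ae (ae_restrict_of_ae hvnn))) hz
  filter_upwards [hmain] with x hx hxT
  exact sub_eq_zero.mp (hx hxT)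

/-! ### Autoconvolution on the unit interval -/

/-- Extension by zero of a function on the unit interval. -/
noncomputable abbrev unitExtend (w : ℝ → ℝ) : ℝ → ℝ := (Icc 0 1).indicator w

/-- The autoconvolution of a function on the unit interval, extended by zero. -/
noncomputable def unitAutoconv (w : ℝ → ℝ) : ℝ → ℝ :=
  unitExtend w ⋆[ContinuousLinearMap.mul ℝ ℝ] unitExtend w

theorem unitExtend_of_neg (w : ℝ → ℝ) {t : ℝ} (ht : t < 0) : unitExtend w t = 0 :=
  indicator_of_notMem (fun h => ht.not_ge h.1) w

theorem integrable_unitExtend {w : ℝ → ℝ} (hw : Integrable w unitIntervalMeasure) :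
    Integrable (unitExtend w) :=
  (integrable_indicator_iff measurableSet_Icc).mpr hw

theorem unitExtend_nonneg {w : ℝ → ℝ} (hw : ∀ᵐ t ∂unitIntervalMeasure, 0 ≤ w t) :
    ∀ᵐ t, 0 ≤ unitExtend w t := by
  filter_upwards [(ae_restrict_iff' measurableSet_Icc).mp hw] with t ht
  exact indicator_apply_nonneg ht

theorem unitAutoconv_nonneg {w : ℝ → ℝ} (hw : ∀ᵐ t ∂unitIntervalMeasure, 0 ≤ w t) (s : ℝ) :
    0 ≤ unitAutoconv w s :=
  convolution_mul_self_nonneg (unitExtend_nonneg hw) s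

theorem unitAutoconv_eq_intervalIntegral (w : ℝ → ℝ) {s : ℝ} (hs : s ∈ Icc (0 : ℝ) 1) :
    unitAutoconv w s = ∫ t in (0 : ℝ)..s, w (s - t) * w t := by
  rw [intervalIntegral.integral_of_le hs.1, ← integral_Icc_eq_integral_Ioc,
    ← integral_indicator measurableSet_Icc, unitAutoconv, convolution]
  congr 1 with t
  simp only [ContinuousLinearMap.mul_apply']
  by_cases ht : t ∈ Icc 0 s
  · rw [indicator_of_mem ht, unitExtend,
      indicator_of_mem (show t ∈ Icc (0 : ℝ) 1 from ⟨ht.1, ht.2.trans hs.2⟩),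
      indicator_of_mem (show s - t ∈ Icc (0 : ℝ) 1 from
        ⟨sub_nonneg.mpr ht.2, by linarith [ht.1, hs.2]⟩), mul_comm]
  · rw [indicator_of_notMem ht]
    rcases lt_or_ge t 0 with h | h
    · rw [unitExtend_of_neg w h, zero_mul]
    · have : s - t < 0 := by
        by_contra h'
        exact ht ⟨h, by linarith⟩
      rw [unitExtend_of_neg w this, mul_zero]

theorem ae_lt_one_of_ae_unitIntervalMeasure {p : ℝ → Prop} (h : ∀ᵐ t ∂unitIntervalMeasure, p t)
    (hneg : ∀ t < 0, p t) : ∀ᵐ t : ℝ, t < 1 → p t := by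
  filter_upwards [(ae_restrict_iff' measurableSet_Icc).mp h] with t ht ht1
  rcases lt_or_ge t 0 with h0 | h0
  · exact hneg t h0
  · exact ht ⟨h0, ht1.le⟩

theorem ae_unitIntervalMeasure_of_ae_lt_one {p : ℝ → Prop} (h : ∀ᵐ t : ℝ, t < 1 → p t) :
    ∀ᵐ t ∂unitIntervalMeasure, 0 ≤ t ∧ t ≤ 1 ∧ p t := by
  rw [ae_restrict_iff' measurableSet_Icc]
  filter_upwards [h, compl_mem_ae_iff.mpr (measure_singleton (1 : ℝ))] with t ht ht1 hmem
  exact ⟨hmem.1, hmem.2, ht (lt_of_le_of_ne hmem.2 ht1)⟩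

theorem ae_eq_sqrt_mul_of_unitAutoconv_eq {u v : ℝ → ℝ} (hu : Integrable u unitIntervalMeasure)
    (hv : Integrable v unitIntervalMeasure) (hunn : ∀ᵐ t ∂unitIntervalMeasure, 0 ≤ u t)
    (hvnn : ∀ᵐ t ∂unitIntervalMeasure, 0 ≤ v t)
    (hupos : ∀ ε > 0, 0 < ∫ t in Iic ε, unitExtend u t) {c : ℝ} (hc : 0 ≤ c)
    (h : ∀ᵐ s ∂unitIntervalMeasure, unitAutoconv u s = c * unitAutoconv v s) :
    ∀ᵐ t ∂unitIntervalMeasure, u t = √c * v t := by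
  have h1 : ∀ᵐ s : ℝ, s < 1 → unitAutoconv u s = c * unitAutoconv v s :=
    ae_lt_one_of_ae_unitIntervalMeasure h fun s hs => by
      rw [unitAutoconv, unitAutoconv,
        convolution_mul_self_eq_zero_of_neg (fun _ => unitExtend_of_neg u) hs,
        convolution_mul_self_eq_zero_of_neg (fun _ => unitExtend_of_neg v) hs, mul_zero]
  have h2 := ae_eq_of_convolution_mul_self_eq (T := 1) (integrable_unitExtend hu)
    ((integrable_unitExtend hv).const_mul (√c)) (fun _ => unitExtend_of_neg u)
    (fun t ht => by rw [unitExtend_of_neg v ht, mul_zero]) (unitExtend_nonneg hunn)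
    ((unitExtend_nonneg hvnn).mono fun t ht => mul_nonneg (Real.sqrt_nonneg c) ht) hupos (by
      filter_upwards [h1] with s hs hs1
      rw [convolution_mul_self_const_mul, Real.sq_sqrt hc]
      exact hs hs1)
  filter_upwards [ae_unitIntervalMeasure_of_ae_lt_one h2] with t ⟨ht0, ht1, ht⟩
  simpa only [unitExtend, indicator_of_mem (show t ∈ Icc (0 : ℝ) 1 from ⟨ht0, ht1⟩)] using ht

/-- Uniqueness with constant c = 0 would force u = √0·u = 0 a.e. -/
theorem not_ae_unitAutoconv_eq_zero {u : ℝ → ℝ} (hu : Integrable u unitIntervalMeasure)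
    (hunn : ∀ᵐ t ∂unitIntervalMeasure, 0 ≤ u t)
    (hupos : ∀ ε > 0, 0 < ∫ t in Iic ε, unitExtend u t) :
    ¬ ∀ᵐ s ∂unitIntervalMeasure, unitAutoconv u s = 0 := by
  intro h
  have h1 := ae_eq_sqrt_mul_of_unitAutoconv_eq hu hu hunn hunn hupos le_rfl (by simpa using h)
  refine (hupos 1 one_pos).ne' (integral_eq_zero_of_ae (ae_restrict_of_ae ?_))
  filter_upwards [(ae_restrict_iff' measurableSet_Icc).mp h1] with t ht
  by_cases hmem : t ∈ Icc (0 : ℝ) 1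
  · simpa [unitExtend, indicator_of_mem hmem] using ht hmem
  · simp [unitExtend, indicator_of_notMem hmem]

/-! ### Factored functions on the unit square -/

theorem unitSquareMeasure_eq_prod :
    unitSquareMeasure = unitIntervalMeasure.prod unitIntervalMeasure := by
  rw [Measure.prod_restrict, Icc_prod_Icc, ← Measure.volume_eq_prod]

/-- This holds at every s in the square: the reflection t ↦ s - t preserves null sets, so both
factors of the integrand split for a.e. t. -/
theorem autoconv_eq_mul_unitAutoconv {x : ℝ × ℝ → ℝ} {x₁ x₂ : ℝ → ℝ}
    (h : ∀ᵐ t ∂unitSquareMeasure, x t = x₁ t.1 * x₂ t.2) {s : ℝ × ℝ}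
    (hs : s ∈ Icc ((0, 0) : ℝ × ℝ) (1, 1)) :
    autoconv x s = unitAutoconv x₁ s.1 * unitAutoconv x₂ s.2 := by
  rw [Icc_prod_eq] at hs
  obtain ⟨hs1, hs2⟩ := hs
  rw [ae_restrict_iff' measurableSet_Icc] at h
  have hrefl : ∀ᵐ t : ℝ × ℝ, s - t ∈ Icc ((0, 0) : ℝ × ℝ) (1, 1) →
      x (s - t) = x₁ (s - t).1 * x₂ (s - t).2 :=
    (Measure.measurePreserving_sub_left volume s).quasiMeasurePreserving.ae h
  have hswap : ∀ᵐ t₂ : ℝ, ∀ᵐ t₁ : ℝ, t₂ ∈ uIoc 0 s.2 → t₁ ∈ uIoc 0 s.1 →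
      x (s.1 - t₁, s.2 - t₂) * x (t₁, t₂) =
        (x₂ (s.2 - t₂) * x₂ t₂) * (x₁ (s.1 - t₁) * x₁ t₁) := by
    refine Measure.ae_ae_of_ae_prod (p := fun z : ℝ × ℝ => z.1 ∈ uIoc 0 s.2 → z.2 ∈ uIoc 0 s.1 →
      x (s.1 - z.2, s.2 - z.1) * x (z.2, z.1) =
        (x₂ (s.2 - z.1) * x₂ z.1) * (x₁ (s.1 - z.2) * x₁ z.2)) ?_
    refine Measure.measurePreserving_swap.quasiMeasurePreserving.ae
      (p := fun t : ℝ × ℝ => t.2 ∈ uIoc 0 s.2 → t.1 ∈ uIoc 0 s.1 →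
        x (s.1 - t.1, s.2 - t.2) * x (t.1, t.2) =
          (x₂ (s.2 - t.2) * x₂ t.2) * (x₁ (s.1 - t.1) * x₁ t.1)) ?_
    rw [← Measure.volume_eq_prod]
    filter_upwards [h, hrefl] with t ht ht' h2 h1
    rw [uIoc_of_le hs2.1] at h2
    rw [uIoc_of_le hs1.1] at h1
    simp only [mem_Ioc, mem_Icc] at h1 h2 hs1 hs2
    have e1 : x t = x₁ t.1 * x₂ t.2 :=
      ht ⟨⟨h1.1.le, h2.1.le⟩, ⟨h1.2.trans hs1.2, h2.2.trans hs2.2⟩⟩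
    have e2 : x (s.1 - t.1, s.2 - t.2) = x₁ (s.1 - t.1) * x₂ (s.2 - t.2) :=
      ht' ⟨⟨sub_nonneg.mpr h1.2, sub_nonneg.mpr h2.2⟩,
        ⟨by simp only [Prod.fst_sub]; linarith, by simp only [Prod.snd_sub]; linarith⟩⟩
    rw [e2, show (t.1, t.2) = t from rfl, e1]
    ring
  rw [unitAutoconv_eq_intervalIntegral _ hs1, unitAutoconv_eq_intervalIntegral _ hs2, autoconv,
    mul_comm, ← intervalIntegral.integral_mul_const]
  refine intervalIntegral.integral_congr_ae ?_
  filter_upwards [hswap] with t₂ ht₂ hmem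
  rw [← intervalIntegral.integral_const_mul]
  refine intervalIntegral.integral_congr_ae ?_
  filter_upwards [ht₂] with t₁ ht₁ using ht₁ hmem

theorem exists_pos_ae_eq_const_mul_of_ae_mul_eq_mul {α β : Type*} [MeasurableSpace α]
    [MeasurableSpace β] {μ : Measure α} {ν : Measure β} [SFinite μ] [SFinite ν]
    {A₁ B₁ : α → ℝ} {A₂ B₂ : β → ℝ}
    (h : ∀ᵐ z ∂μ.prod ν, A₁ z.1 * A₂ z.2 = B₁ z.1 * B₂ z.2)
    (hA₁ : ¬ ∀ᵐ a ∂μ, A₁ a = 0) (hA₂ : ¬ ∀ᵐ b ∂ν, A₂ b = 0)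
    (hA₂nn : ∀ b, 0 ≤ A₂ b) (hB₂nn : ∀ b, 0 ≤ B₂ b) :
    ∃ c > 0, (∀ᵐ a ∂μ, A₁ a = c * B₁ a) ∧ ∀ᵐ b ∂ν, B₂ b = c * A₂ b := by
  have hswap : ∀ᵐ b ∂ν, ∀ᵐ a ∂μ, A₁ a * A₂ b = B₁ a * B₂ b :=
    Measure.ae_ae_of_ae_prod (p := fun z : β × α => A₁ z.2 * A₂ z.1 = B₁ z.2 * B₂ z.1)
      -- The swap allows fixing the second variable first: a generic b with A₂ b ≠ 0 yields c = B₂ b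
      -- / A₂ b.
      (Measure.measurePreserving_swap.quasiMeasurePreserving.ae h)
  obtain ⟨b, hb0, hb⟩ := ((not_eventually.mp hA₂).and_eventually hswap).exists
  have h1 : ∀ᵐ a ∂μ, A₁ a = B₂ b / A₂ b * B₁ a := by
    filter_upwards [hb] with a ha
    field_simp
    linarith
  have hc : 0 < B₂ b / A₂ b := by
    refine (div_nonneg (hB₂nn b) (hA₂nn b)).lt_of_ne fun h0 => hA₁ ?_
    simpa [← h0] using h1
  refine ⟨_, hc, h1, ?_⟩
  obtain ⟨a, ha0, ha1, ha⟩ := ((not_eventually.mp hA₁).and_eventually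
    (h1.and (Measure.ae_ae_of_ae_prod h))).exists
  have hB₁ : B₁ a ≠ 0 := fun h0 => ha0 (by rw [ha1, h0, mul_zero])
  filter_upwards [ha] with b' hb'
  refine mul_left_cancel₀ hB₁ ?_
  rw [← hb', ha1]
  ring

/-- If the integral were 0, then w = 0 a.e. up to ε, so x would vanish a.e. on the part of the
square where p < ε, which is a neighbourhood of the origin. It is applied to both coordinate
projections p. -/
theorem setIntegral_unitExtend_pos_of_mem_essSupport {x : L2Square}
    (h0 : (0, 0) ∈ essSupport x) {p : ℝ × ℝ → ℝ} (hp : Continuous p) (hp0 : p (0, 0) = 0)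
    (hpq : Measure.QuasiMeasurePreserving p volume volume)
    (hpI : ∀ t ∈ Icc ((0, 0) : ℝ × ℝ) (1, 1), p t ∈ Icc (0 : ℝ) 1)
    {w : ℝ → ℝ} (hw : Integrable w unitIntervalMeasure)
    (hwnn : ∀ᵐ t ∂unitIntervalMeasure, 0 ≤ w t)
    (hx : ∀ᵐ t ∂unitSquareMeasure, w (p t) = 0 → x t = 0) {ε : ℝ} (hε : 0 < ε) :
    0 < ∫ t in Iic ε, unitExtend w t := by
  have hnn := unitExtend_nonneg hwnn
  refine (integral_nonneg_of_ae (ae_restrict_of_ae hnn)).lt_of_ne fun h => ?_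
  have hz := (setIntegral_eq_zero_iff_of_nonneg_ae (ae_restrict_of_ae hnn)
    (integrable_unitExtend hw).integrableOn).mp h.symm
  rw [EventuallyEq, ae_restrict_iff' measurableSet_Iic] at hz
  rw [ae_restrict_iff' measurableSet_Icc] at hx
  have hU : p ⁻¹' Iio ε ∈ 𝓝 ((0, 0) : ℝ × ℝ) :=
    hp.continuousAt.preimage_mem_nhds (Iio_mem_nhds (by rwa [hp0]))
  refine (h0 _ hU).ne' ?_
  have hae : ∀ᵐ t : ℝ × ℝ, ¬ (t ∈ p ⁻¹' Iio ε ∩ Icc (0, 0) (1, 1) ∧ x t ≠ 0) := by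
    filter_upwards [hx, hpq.ae hz] with t ht hzt ⟨⟨htU, htI⟩, hne⟩
    refine hne (ht htI ?_)
    have := hzt (le_of_lt (show p t < ε from htU))
    rwa [unitExtend, indicator_of_mem (hpI t htI)] at this
  rw [ae_iff] at hae
  simpa only [not_not] using hae

theorem theorem2p3 (y x : L2Square)
    (hx : IsNonnegFactoredLimitedSolution y x)
    (h0 : (0, 0) ∈ essSupport x)
    (x' : L2Square) (hx' : IsNonnegFactoredLimitedSolution y x') :
    x' = x := by
  obtain ⟨hsol, x₁, x₂, hx₁, hx₂, hfac⟩ := hx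
  obtain ⟨hsol', x₁', x₂', hx₁', hx₂', hfac'⟩ := hx'
  have hint : ∀ w : L2Interval, Integrable w unitIntervalMeasure := fun w =>
    (Lp.memLp w).integrable one_le_two
  have hpos₁ : ∀ ε > 0, 0 < ∫ t in Iic ε, unitExtend x₁ t := fun ε hε =>
    setIntegral_unitExtend_pos_of_mem_essSupport h0 continuous_fst rfl
      Measure.quasiMeasurePreserving_fst (fun t ht => ⟨ht.1.1, ht.2.1⟩) (hint x₁) hx₁
      (hfac.mono fun t ht hz => by rw [ht, hz, zero_mul]) hε
  have hpos₂ : ∀ ε > 0, 0 < ∫ t in Iic ε, unitExtend x₂ t := fun ε hε =>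
    setIntegral_unitExtend_pos_of_mem_essSupport h0 continuous_snd rfl
      Measure.quasiMeasurePreserving_snd (fun t ht => ⟨ht.1.2, ht.2.2⟩) (hint x₂) hx₂
      (hfac.mono fun t ht hz => by rw [ht, hz, mul_zero]) hε
  have hprod : ∀ᵐ s ∂unitIntervalMeasure.prod unitIntervalMeasure,
      unitAutoconv x₁ s.1 * unitAutoconv x₂ s.2 = unitAutoconv x₁' s.1 * unitAutoconv x₂' s.2 := by
    rw [← unitSquareMeasure_eq_prod]
    filter_upwards [hsol, hsol', ae_restrict_mem measurableSet_Icc] with s hs hs' hmem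
    rw [← autoconv_eq_mul_unitAutoconv hfac hmem, ← autoconv_eq_mul_unitAutoconv hfac' hmem,
      hs, hs']
  obtain ⟨c, hc, hc₁, hc₂⟩ := exists_pos_ae_eq_const_mul_of_ae_mul_eq_mul hprod
    (not_ae_unitAutoconv_eq_zero (hint x₁) hx₁ hpos₁)
    (not_ae_unitAutoconv_eq_zero (hint x₂) hx₂ hpos₂)
    (unitAutoconv_nonneg hx₂) (unitAutoconv_nonneg hx₂')
  have h₁ := ae_eq_sqrt_mul_of_unitAutoconv_eq (hint x₁) (hint x₁') hx₁ hx₁' hpos₁ hc.le hc₁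
  have h₂ := ae_eq_sqrt_mul_of_unitAutoconv_eq (hint x₂) (hint x₂') hx₂ hx₂' hpos₂
    (inv_nonneg.mpr hc.le) (hc₂.mono fun s hs => by rw [hs, inv_mul_cancel_left₀ hc.ne'])
  refine Lp.ext ?_
  have h₁' : ∀ᵐ t ∂unitSquareMeasure, x₁ t.1 = √c * x₁' t.1 := by
    rw [unitSquareMeasure_eq_prod]
    exact Measure.quasiMeasurePreserving_fst.ae h₁
  have h₂' : ∀ᵐ t ∂unitSquareMeasure, x₂ t.2 = √c⁻¹ * x₂' t.2 := by
    rw [unitSquareMeasure_eq_prod]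
    exact Measure.quasiMeasurePreserving_snd.ae h₂
  filter_upwards [hfac, hfac', h₁', h₂'] with t ht ht' ht₁ ht₂
  have hsqrt : √c * √c⁻¹ = 1 := by
    rw [← Real.sqrt_mul hc.le, mul_inv_cancel₀ hc.ne', Real.sqrt_one]
  rw [ht, ht', ht₁, ht₂]
  linear_combination (-(x₁' t.1 * x₂' t.2)) * hsqrt
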